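/- Let $(\xi_n)_{n\ge 1}$ be independent random variables, each uniformly distributed on $[0,1]$, and let $T_n$ be the binary search tree built from $\xi_1,\dots,\xi_n$: the values are inserted one after the other, each moving down from the root, to the left if it is smaller and to the right if it is greater than the label of the current node, until an empty node is found, where it is attached. Regard $T_n$ as a finite prefix-stable set of words over $\{0,1\}$ (0 = left, 1 = right, the root is the empty word). For $s\in[0,1]$ let $s=\sum_{k\ge1}u_k2^{-k}$ be its binary expansion, where for $s<1$ the expansion not ending in ones is taken (and $u_k=1$ for all $k$ if $s=1$), and let $$X(T_n,s)=\min\{k\ge 0:(u_1,\dots,u_k)\notin T_n\}$$ be the silhouette of $T_n$ at $s$. Let $0\le s_1<\dots<s_d\le1$ be fixed and put $$Y_{n,l}=\frac{X(T_n,s_l)-\log n}{\sqrt{\log n}},\qquad l=1,\dots,d.$$ Then, as $n\to\infty$, the random vectors $(Y_{n,1},\dots,Y_{n,d})$ converge in distribution to the $d$-dimensional standard normal law. In particular, the silhouette values at distinct points become asymptotically independent: for all $x_1,\dots,x_d\in\mathbb R$, $$P(Y_{n,1}\le x_1,\dots,Y_{n,d}\le x_d)-\prod_{l=1}^dP(Y_{n,l}\le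 x_l)\to0 .$$ -/

import Mathlib

open MeasureTheory ProbabilityTheory Filter Topology

noncomputable section

namespace Silhouette

/-- A rooted directed binary tree: a finite prefix-stable set of finite words over a two-letter
alphabet. The letter `false` (zero) means a move to the left, `true` (one) a move to the right. -/
structure BinTree where
  /-- The (internal) nodes. -/
  nodes : Finset (List Bool)
  /-- The predecessor of a node is a node. -/
  prefix_stable : ∀ (u : List Bool) (b : Bool), u ++ [b] ∈ nodes → u ∈ nodes

/-- The digits `u_1, u_2, …` (here indexed from zero) of the binary expansion of `s ∈ [0, 1]`.
`Real.digits s 2 k` is `⌊s * 2 ^ (k + 1)⌋ mod 2`; for `s < 1` this is the expansion that does not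
end in ones. All digits of `1` are one. -/
def binaryDigit (s : ℝ) (k : ℕ) : Bool :=
  decide (s = 1 ∨ Real.digits s 2 k = 1)

/-- The word `(u_1, …, u_k)` made of the first `k` binary digits of `s`. -/
def digitWord (s : ℝ) (k : ℕ) : List Bool :=
  (List.range k).map (binaryDigit s)

theorem length_digitWord (s : ℝ) (k : ℕ) : (digitWord s k).length = k := by
  simp [digitWord]

/-- A finite tree is eventually left along each path. -/
theorem exists_digitWord_notMem (T : BinTree) (s : ℝ) : ∃ k, digitWord s k ∉ T.nodes := by
  by_contra! h
  have hinj : Function.Injective (digitWord s) := fun a b hab => by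
    have := congrArg List.length hab
    simpa [length_digitWord] using this
  exact Set.infinite_of_injective_forall_mem hinj h T.nodes.finite_toSet

/-- The silhouette `X_s(T) = min {k : (u_1, …, u_k) ∉ T}`. -/
def silhouette (T : BinTree) (s : ℝ) : ℕ :=
  Nat.find (exists_digitWord_notMem T s)

/-- The nodes of a labeled binary tree as words: the root is the empty word, and a node of the left
(right) subtree has `false` (`true`) put in front of it. -/
def nodeSet {α : Type*} : BinaryTree α → Finset (List Bool)
  | .nil => ∅
  | .node _ l r =>
      insert [] ((nodeSet l).image (List.cons false) ∪ (nodeSet r).image (List.cons true))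

theorem nodeSet_prefix_stable {α : Type*} (t : BinaryTree α) :
    ∀ (u : List Bool) (b : Bool), u ++ [b] ∈ nodeSet t → u ∈ nodeSet t := by
  induction t with
  | nil => simp [nodeSet]
  | node a l r hl hr =>
    rintro (_ | ⟨c, u⟩) b h
    · simp [nodeSet]
    · cases c <;> simp [nodeSet] at h ⊢
      · exact hl u b h
      · exact hr u b h

/-- The binary tree that results from a labeled binary tree by forgetting the labels. -/
def shape {α : Type*} (t : BinaryTree α) : BinTree :=
  ⟨nodeSet t, nodeSet_prefix_stable t⟩

/-- One step of the binary search tree algorithm: starting at the root, move to the left if `x` is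
smaller than the label of the current node and to the right otherwise, until an empty node is
found; this becomes a new node with label `x`. (Equal labels have probability zero below.) -/
def bstInsert (x : ℝ) : BinaryTree ℝ → BinaryTree ℝ
  | .nil => .node x .nil .nil
  | .node a l r => if x < a then .node a (bstInsert x l) r else .node a l (bstInsert x r)

/-- The labeled tree that the binary search tree algorithm builds from the first `n` terms
`x 0, …, x (n - 1)` of the input sequence `x`. -/
def bstLabeled (x : ℕ → ℝ) : ℕ → BinaryTree ℝ
  | 0 => .nil
  | n + 1 => bstInsert (x n) (bstLabeled x n)

/-- The binary search tree built from the first `n` terms of the input sequence `x`. -/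
def bst (x : ℕ → ℝ) (n : ℕ) : BinTree :=
  shape (bstLabeled x n)

/-- The standardized silhouette value `(X(T_n, s) - log n) / √(log n)` for the binary search tree
`T_n` built from the first `n` terms of `x`. -/
def standardizedSilhouette (x : ℕ → ℝ) (n : ℕ) (s : ℝ) : ℝ :=
  ((silhouette (bst x n) s : ℝ) - Real.log n) / √(Real.log n)

end Silhouette

end

/-! Follow an infinite path `u` through the growing tree and record its depth (nodes of the tree on
it) and its index (labels to the left of the empty place where it exits). With distinct labels, a
new label lands in that place exactly if its rank among the earlier labels equals the index. So
depth and index are driven by the ranks alone (`path_bstInsert`, `pathState`), and given the first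
`n` ranks the next is uniform on `{0, …, n}` (`integral_rank`).

Once two paths have separated, their indices differ for ever, so at most one depth grows per step.
Hence, on the event that all paths have separated by time `m`, step `n` multiplies the joint
generating function `E ∏ z_l ^ depth_l` by exactly `1 + (∑ (z_l - 1)) / (n + 1)`. The paths enter
this factor additively, which is the source of asymptotic independence.

With `z_l = exp(i θ_l / √(log n))` the product behaves like `exp(log n · ∑ (z_l - 1))`; the linear
Taylor term cancels the centering and the quadratic one leaves `exp(-∑ θ_l² / 2)`. The separation
event has probability tending to one as `m → ∞`, so Lévy's continuity theorem gives the normal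
limit. The statement on distribution functions follows because orthants have Gaussian-null boundary.
-/

namespace Silhouette

/-! ### Depth and index of a path under insertion -/

/-- The number of nodes of a tree on the infinite path `u`. -/
def pathDepth {α : Type*} : BinaryTree α → (ℕ → Bool) → ℕ
  | .nil, _ => 0
  | .node _ l r, u =>
      (if u 0 then pathDepth r (fun i => u (i + 1)) else pathDepth l (fun i => u (i + 1))) + 1

/-- The labels of a tree in symmetric order. -/
def labels {α : Type*} : BinaryTree α → List α
  | .nil => []
  | .node a l r => labels l ++ a :: labels r

/-- The number of nodes that precede, in symmetric order, the empty place at which the path `u`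
leaves the tree. -/
def pathIndex {α : Type*} : BinaryTree α → (ℕ → Bool) → ℕ
  | .nil, _ => 0
  | .node _ l r, u =>
      if u 0 then (labels l).length + 1 + pathIndex r (fun i => u (i + 1))
      else pathIndex l (fun i => u (i + 1))

theorem map_range_mem_nodeSet {α : Type*} (t : BinaryTree α) (u : ℕ → Bool) (k : ℕ) :
    (List.range k).map u ∈ nodeSet t ↔ k < pathDepth t u := by
  induction t generalizing u k with
  | nil => simp [nodeSet, pathDepth]
  | node a l r hl hr =>
    cases k with
    | zero => simp [nodeSet, pathDepth]
    | succ k =>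
      have hl' := hl (fun i => u (i + 1)) k
      have hr' := hr (fun i => u (i + 1)) k
      rw [List.range_succ_eq_map]
      cases h : u 0 <;>
        simp [nodeSet, pathDepth, h, ← hl', ← hr', Function.comp_def]

theorem silhouette_shape {α : Type*} (t : BinaryTree α) (s : ℝ) :
    silhouette (shape t) s = pathDepth t (binaryDigit s) := by
  unfold silhouette
  rw [Nat.find_eq_iff]
  have h := map_range_mem_nodeSet t (binaryDigit s)
  constructor
  · exact fun hc => lt_irrefl _ ((h _).1 hc)
  · intro k hk hc
    exact hc ((h k).2 hk)

theorem labels_bstInsert_perm (x : ℝ) (t : BinaryTree ℝ) :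
    (labels (bstInsert x t)).Perm (x :: labels t) := by
  induction t with
  | nil => simp [bstInsert, labels]
  | node a l r hl hr =>
    unfold bstInsert
    split_ifs with h
    · simpa [labels] using hl.append_right (a :: labels r)
    · simp only [labels]
      refine ((hr.cons a).append_left (labels l)).trans ?_
      refine ((List.Perm.swap x a (labels r)).append_left (labels l)).trans ?_
      exact List.perm_middle

theorem labels_bstInsert_pairwise {x : ℝ} {t : BinaryTree ℝ} (ht : (labels t).Pairwise (· < ·))
    (hx : x ∉ labels t) : (labels (bstInsert x t)).Pairwise (· < ·) := by
  induction t with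
  | nil => simp [bstInsert, labels]
  | node a l r hl hr =>
    simp only [labels, List.pairwise_append, List.pairwise_cons, List.mem_append,
      List.mem_cons, not_or] at ht hx
    obtain ⟨h1, ⟨h2, h3⟩, h4⟩ := ht
    obtain ⟨x1, x2, x3⟩ := hx
    unfold bstInsert
    split_ifs with h
    · simp only [labels, List.pairwise_append, List.pairwise_cons, List.mem_cons]
      refine ⟨hl h1 x1, ⟨h2, h3⟩, fun b hb c hc => ?_⟩
      rcases List.mem_cons.1 ((labels_bstInsert_perm x l).mem_iff.1 hb) with rfl | hb
      · rcases hc with rfl | hc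
        · exact h
        · exact h.trans (h2 c hc)
      · exact h4 b hb c hc
    · have h' : a < x := lt_of_le_of_ne (not_lt.1 h) (Ne.symm x2)
      simp only [labels, List.pairwise_append, List.pairwise_cons, List.mem_cons]
      refine ⟨h1, ⟨fun c hc => ?_, hr h3 x3⟩, fun b hb c hc => ?_⟩
      · rcases List.mem_cons.1 ((labels_bstInsert_perm x r).mem_iff.1 hc) with rfl | hc
        · exact h'
        · exact h2 c hc
      · rcases hc with rfl | hc
        · exact h4 b hb c (Or.inl rfl)
        rcases List.mem_cons.1 ((labels_bstInsert_perm x r).mem_iff.1 hc) with rfl | hc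
        · exact (h4 b hb a (Or.inl rfl)).trans h'
        · exact h4 b hb c (Or.inr hc)

theorem pathIndex_le {α : Type*} (t : BinaryTree α) (u : ℕ → Bool) :
    pathIndex t u ≤ (labels t).length := by
  induction t generalizing u with
  | nil => simp [pathIndex]
  | node a l r hl hr =>
    have hl' := hl (fun i => u (i + 1))
    have hr' := hr (fun i => u (i + 1))
    simp only [pathIndex, labels, List.length_append, List.length_cons]
    split_ifs <;> omega

/-- A new label is attached on the path `u` exactly if its rank is the index of the path. -/
theorem path_bstInsert {x : ℝ} {t : BinaryTree ℝ} (ht : (labels t).Pairwise (· < ·))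
    (hx : x ∉ labels t) (u : ℕ → Bool) :
    pathDepth (bstInsert x t) u =
        (if (labels t).countP (· < x) = pathIndex t u then pathDepth t u + 1 else pathDepth t u) ∧
      pathIndex (bstInsert x t) u =
        if (labels t).countP (· < x) < pathIndex t u ∨
            (labels t).countP (· < x) = pathIndex t u ∧ u (pathDepth t u) = true
          then pathIndex t u + 1 else pathIndex t u := by
  induction t generalizing u with
  | nil => cases h : u 0 <;> simp [bstInsert, labels, pathDepth, pathIndex, h]
  | node a l r hl hr =>
    simp only [labels, List.pairwise_append, List.pairwise_cons, List.mem_append,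
      List.mem_cons, not_or] at ht hx
    obtain ⟨h1, ⟨h2, h3⟩, h4⟩ := ht
    obtain ⟨x1, x2, x3⟩ := hx
    obtain ⟨dl, il⟩ := hl h1 x1 (fun i => u (i + 1))
    obtain ⟨dr, ir⟩ := hr h3 x3 (fun i => u (i + 1))
    have bl := pathIndex_le l (fun i => u (i + 1))
    have cl : (labels l).countP (· < x) ≤ (labels l).length := List.countP_le_length
    have pl := (labels_bstInsert_perm x l).length_eq
    rw [List.length_cons] at pl
    by_cases h : x < a
    · have cr : (labels r).countP (· < x) = 0 := by
        rw [List.countP_eq_zero]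
        intro b hb
        simpa using (h.trans (h2 b hb)).le
      cases h0 : u 0 <;>
        simp only [bstInsert, h, if_true, labels, pathDepth, pathIndex, List.countP_append,
          List.countP_cons, h0, cr, dl, il, pl, not_lt.2 h.le, decide_false, Bool.false_eq_true,
          if_false] <;> refine ⟨?_, ?_⟩ <;> grind
    · have h' : a < x := lt_of_le_of_ne (not_lt.1 h) (Ne.symm x2)
      have cl' : (labels l).countP (· < x) = (labels l).length := by
        rw [List.countP_eq_length]
        intro b hb
        simpa using (h4 b hb a (Or.inl rfl)).trans h'
      cases h0 : u 0 <;>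
        simp only [bstInsert, h, labels, pathDepth, pathIndex, List.countP_append,
          List.countP_cons, h0, cl', dr, ir, h', decide_true, Bool.false_eq_true,
          if_false, if_true] <;> refine ⟨?_, ?_⟩ <;> grind

/-! ### Paths as functionals of the rank sequence -/

/-- The number of earlier terms of `x` that are smaller than `x n`. -/
noncomputable def rank (x : ℕ → ℝ) (n : ℕ) : ℕ :=
  (List.range n).countP (fun i => x i < x n)

/-- The depth and the index of the path `u` as a function of the sequence of ranks. -/
def pathState (u : ℕ → Bool) (ρ : ℕ → ℕ) : ℕ → ℕ × ℕ
  | 0 => (0, 0)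
  | n + 1 =>
      (if ρ n = (pathState u ρ n).2 then (pathState u ρ n).1 + 1 else (pathState u ρ n).1,
        if ρ n < (pathState u ρ n).2 ∨ ρ n = (pathState u ρ n).2 ∧ u (pathState u ρ n).1 = true
          then (pathState u ρ n).2 + 1 else (pathState u ρ n).2)

theorem labels_bstLabeled_perm (x : ℕ → ℝ) (n : ℕ) :
    (labels (bstLabeled x n)).Perm ((List.range n).map x) := by
  induction n with
  | zero => simp [bstLabeled, labels]
  | succ n ih =>
    rw [bstLabeled, List.range_succ, List.map_append]
    refine (labels_bstInsert_perm _ _).trans ((ih.cons _).trans ?_)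
    simpa using (List.perm_append_singleton (x n) ((List.range n).map x)).symm

theorem labels_bstLabeled_pairwise {x : ℕ → ℝ} (hx : Function.Injective x) (n : ℕ) :
    (labels (bstLabeled x n)).Pairwise (· < ·) := by
  induction n with
  | zero => simp [bstLabeled, labels]
  | succ n ih =>
    refine labels_bstInsert_pairwise ih fun h => ?_
    have := (labels_bstLabeled_perm x n).mem_iff.1 h
    obtain ⟨i, hi, hin⟩ := List.mem_map.1 this
    have := hx hin
    simp at hi
    omega

theorem path_bstLabeled {x : ℕ → ℝ} (hx : Function.Injective x) (u : ℕ → Bool) (n : ℕ) :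
    pathDepth (bstLabeled x n) u = (pathState u (rank x) n).1 ∧
      pathIndex (bstLabeled x n) u = (pathState u (rank x) n).2 := by
  induction n with
  | zero => simp [bstLabeled, pathDepth, pathIndex, pathState]
  | succ n ih =>
    have hn : x n ∉ labels (bstLabeled x n) := fun h => by
      obtain ⟨i, hi, hin⟩ := List.mem_map.1 ((labels_bstLabeled_perm x n).mem_iff.1 h)
      have := hx hin
      simp at hi
      omega
    have hc : (labels (bstLabeled x n)).countP (· < x n) = rank x n := by
      rw [(labels_bstLabeled_perm x n).countP_eq, List.countP_map]
      rfl
    have := path_bstInsert (labels_bstLabeled_pairwise hx n) hn u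
    rw [hc, ih.1, ih.2] at this
    exact this

theorem silhouette_bst {x : ℕ → ℝ} (hx : Function.Injective x) (n : ℕ) (s : ℝ) :
    silhouette (bst x n) s = (pathState (binaryDigit s) (rank x) n).1 := by
  rw [bst, silhouette_shape, (path_bstLabeled hx _ n).1]

theorem pathState_snd_le (u : ℕ → Bool) (ρ : ℕ → ℕ) (n : ℕ) : (pathState u ρ n).2 ≤ n := by
  induction n with
  | zero => simp [pathState]
  | succ n ih => simp only [pathState]; split_ifs <;> omega

theorem pathState_fst_mono (u : ℕ → Bool) (ρ : ℕ → ℕ) : Monotone fun n => (pathState u ρ n).1 := by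
  refine monotone_nat_of_le_succ fun n => ?_
  simp only [pathState]; split_ifs <;> omega

theorem pathState_congr (u : ℕ → Bool) {ρ ρ' : ℕ → ℕ} {n : ℕ} (h : ∀ i < n, ρ i = ρ' i) :
    pathState u ρ n = pathState u ρ' n := by
  induction n with
  | zero => rfl
  | succ n ih =>
    simp only [pathState, ih fun i hi => h i (by omega), h n (by omega)]

/-- Two paths with the same index at time `n` have not yet separated. -/
theorem pathState_agree {u v : ℕ → Bool} {ρ : ℕ → ℕ} {n : ℕ}
    (h : (pathState u ρ n).2 = (pathState v ρ n).2) :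
    (pathState u ρ n).1 = (pathState v ρ n).1 ∧ ∀ i < (pathState u ρ n).1, u i = v i := by
  induction n with
  | zero => simp [pathState]
  | succ n ih =>
    simp only [pathState] at h ⊢
    -- Paths with equal index can part only at a node just attached to both; equal new indices then
    -- force the same digit there.
    by_cases he : (pathState u ρ n).2 = (pathState v ρ n).2
    · obtain ⟨h1, h2⟩ := ih he
      rw [← he, ← h1] at h ⊢
      refine ⟨rfl, fun i hi => ?_⟩
      split_ifs at hi with hr
      · rcases Nat.lt_succ_iff_lt_or_eq.1 hi with hi | rfl
        · exact h2 i hi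
        · cases hu : u (pathState u ρ n).1 <;> cases hv : v (pathState u ρ n).1 <;>
            simp_all
      · exact h2 i hi
    -- Distinct indices never merge: if the smaller one increases, the rank is at most that index,
    -- hence below the larger one, which increases too.
    · exfalso
      split_ifs at h <;> omega

theorem pathState_snd_ne {u v : ℕ → Bool} {ρ : ℕ → ℕ} {n i : ℕ} (hi : u i ≠ v i)
    (h : i < (pathState u ρ n).1) : (pathState u ρ n).2 ≠ (pathState v ρ n).2 := fun he =>
  hi ((pathState_agree he).2 i h)

/-- The digits sum back to `s`, also for `s = 1`, where the all-ones expansion has value one. Thus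
distinct points give distinct paths. -/
theorem binaryDigit_injOn : Set.InjOn binaryDigit (Set.Icc 0 1) := by
  have key : ∀ s ∈ Set.Icc (0 : ℝ) 1,
      Real.ofDigits (fun k => if binaryDigit s k then (1 : Fin 2) else 0) = s := by
    intro s hs
    rcases eq_or_lt_of_le hs.2 with h | h
    · simpa [binaryDigit, h] using Real.ofDigits_const_last_eq_one' (b := 2) (by norm_num)
    · rw [← Real.ofDigits_digits (b := 2) (by norm_num) ⟨hs.1, h⟩]
      congr 1
      ext1 k
      rw [Real.ofDigits_digits (b := 2) (by norm_num) ⟨hs.1, h⟩]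
      simp only [binaryDigit, h.ne, false_or, decide_eq_true_eq]
      generalize Real.digits s 2 k = a
      fin_cases a <;> rfl
  intro s hs t ht hst
  rw [← key s hs, ← key t ht, hst]

/-! ### Uniform relative order of an i.i.d. sequence -/

theorem measureReal_eq_of_iid {Ω : Type*} [MeasurableSpace Ω] {P : Measure Ω}
    [IsProbabilityMeasure P] {ξ : ℕ → Ω → ℝ} (hmeas : ∀ n, Measurable (ξ n))
    (hindep : iIndepFun ξ P) {μ : Measure ℝ} (hlaw : ∀ n, P.map (ξ n) = μ)
    {n : ℕ} (g : Fin n → ℕ) (hg : Function.Injective g) {A : Set (Fin n → ℝ)}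
    (hA : MeasurableSet A) :
    P.real {ω | (fun i => ξ (g i) ω) ∈ A} = (Measure.pi fun _ : Fin n => μ).real A := by
  have h := (iIndepFun_iff_map_fun_eq_pi_map (fun i => (hmeas (g i)).aemeasurable)).1
    (hindep.precomp hg)
  simp only [hlaw] at h
  rw [← h, map_measureReal_apply (measurable_pi_lambda _ fun i => hmeas (g i)) hA]
  rfl

/-- By Fubini the diagonal is null for the law of each pair, since its sections are singletons. -/
theorem ae_injective {Ω : Type*} [MeasurableSpace Ω] {P : Measure Ω}
    [IsProbabilityMeasure P] {ξ : ℕ → Ω → ℝ} (hmeas : ∀ n, Measurable (ξ n))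
    (hindep : iIndepFun ξ P) (hatom : ∀ n, NullSingletonClass (P.map (ξ n))) :
    ∀ᵐ ω ∂P, Function.Injective fun n => ξ n ω := by
  have h : ∀ i j, i ≠ j → ∀ᵐ ω ∂P, ξ i ω ≠ ξ j ω := by
    intro i j hij
    have hm := (indepFun_iff_map_prod_eq_prod_map_map (hmeas i).aemeasurable
      (hmeas j).aemeasurable).1 (hindep.indepFun hij)
    have hd : MeasurableSet {p : ℝ × ℝ | p.1 = p.2} :=
      measurableSet_eq_fun measurable_fst measurable_snd
    have := hatom j
    have : IsProbabilityMeasure (P.map (ξ j)) :=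
      Measure.isProbabilityMeasure_map (hmeas j).aemeasurable
    have h0 : (P.map fun ω => (ξ i ω, ξ j ω)) {p : ℝ × ℝ | p.1 = p.2} = 0 := by
      rw [hm, Measure.measure_prod_null hd]
      refine Eventually.of_forall fun x => ?_
      have : Prod.mk x ⁻¹' {p : ℝ × ℝ | p.1 = p.2} = {x} := by
        ext y; simp [eq_comm]
      change (P.map (ξ j)) (Prod.mk x ⁻¹' {p : ℝ × ℝ | p.1 = p.2}) = 0
      rw [this]
      exact measure_singleton x
    rw [Measure.map_apply ((hmeas i).prodMk (hmeas j)) hd] at h0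
    rw [ae_iff]
    simpa using h0
  have h' : ∀ᵐ ω ∂P, ∀ i j, i ≠ j → ξ i ω ≠ ξ j ω := by
    simp only [ae_all_iff]
    exact h
  filter_upwards [h'] with ω hω i j hij
  by_contra hne
  exact hω i j hne hij

theorem measurableSet_strictMono_fin (n : ℕ) : MeasurableSet {x : Fin n → ℝ | StrictMono x} := by
  have : {x : Fin n → ℝ | StrictMono x} = ⋂ i, ⋂ j, {x | i < j → x i < x j} := by
    ext x
    simp only [Set.mem_ofPred_eq, Set.mem_iInter]
    rfl
  rw [this]
  refine MeasurableSet.iInter fun i => MeasurableSet.iInter fun j => ?_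
  by_cases h : i < j
  · simpa [h] using measurableSet_lt (measurable_pi_apply i) (measurable_pi_apply j)
  · simp [h]

theorem perm_eq_of_strictMono {n : ℕ} {f : Fin n → ℝ} {σ τ : Equiv.Perm (Fin n)}
    (hσ : StrictMono (f ∘ σ)) (hτ : StrictMono (f ∘ τ)) : σ = τ := by
  have hf : Function.Injective f := fun a b h => by
    have := hσ.injective (a₁ := σ.symm a) (a₂ := σ.symm b) (by simpa using h)
    simpa using this
  have := Tuple.unique_monotone hσ.monotone hτ.monotone
  ext i
  exact congrArg Fin.val (hf (congrFun this i))

/-- The relative order of the first `n` terms of an i.i.d. sequence without atoms is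
uniformly distributed. -/
theorem measureReal_strictMono {Ω : Type*} [MeasurableSpace Ω] {P : Measure Ω}
    [IsProbabilityMeasure P] {ξ : ℕ → Ω → ℝ} (hmeas : ∀ n, Measurable (ξ n))
    (hindep : iIndepFun ξ P) {μ : Measure ℝ} (hlaw : ∀ n, P.map (ξ n) = μ)
    (hμ : NullSingletonClass μ)
    {n : ℕ} (g : Fin n → ℕ) (hg : Function.Injective g) :
    P.real {ω | StrictMono fun i => ξ (g i) ω} = 1 / (n.factorial : ℝ) := by
  set A := {x : Fin n → ℝ | StrictMono x} with hA
  have hAm := measurableSet_strictMono_fin n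
  have hp : ∀ g : Fin n → ℕ, Function.Injective g →
      P.real {ω | StrictMono fun i => ξ (g i) ω} = (Measure.pi fun _ : Fin n => μ).real A :=
    fun g hg => measureReal_eq_of_iid hmeas hindep hlaw g hg hAm
  rw [hp g hg]
  -- The `n!` events, one per order, are disjoint, equally likely by exchangeability, and cover all
  -- outcomes without ties.
  let E : Equiv.Perm (Fin n) → Set Ω := fun σ => {ω | StrictMono fun i => ξ (σ i : Fin n) ω}
  have hEm : ∀ σ, MeasurableSet (E σ) := fun σ =>
    (measurable_pi_lambda (fun ω (i : Fin n) => ξ (σ i : Fin n) ω) fun i => hmeas _) hAm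
  have hE : ∀ σ, P.real (E σ) = (Measure.pi fun _ : Fin n => μ).real A := fun σ =>
    hp (fun i => (σ i : Fin n)) (Fin.val_injective.comp σ.injective)
  have hdisj : Pairwise (Function.onFun Disjoint E) := by
    intro σ τ hστ
    refine Set.disjoint_left.2 fun ω h1 h2 => hστ ?_
    exact perm_eq_of_strictMono (f := fun i : Fin n => ξ i ω) h1 h2
  have hU : P.real (⋃ σ, E σ) = 1 := by
    have : P (⋃ σ, E σ) = 1 := by
      rw [prob_compl_eq_zero_iff (MeasurableSet.iUnion hEm) |>.symm]
      have := ae_injective hmeas hindep (fun n => (hlaw n).symm ▸ hμ)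
      refine measure_mono_null (fun ω hω => ?_) (ae_iff.1 this)
      intro hinj
      refine hω (Set.mem_iUnion.2 ⟨Tuple.sort fun i : Fin n => ξ i ω, ?_⟩)
      refine (Tuple.monotone_sort fun i : Fin n => ξ i ω).strictMono_of_injective ?_
      exact (Function.Injective.comp hinj Fin.val_injective).comp (Equiv.injective _)
    simp [measureReal_def, this]
  rw [measureReal_iUnion_fintype hdisj hEm] at hU
  simp only [hE, Finset.sum_const, Finset.card_univ, Fintype.card_perm, Fintype.card_fin,
    nsmul_eq_mul] at hU
  rw [eq_div_iff (by positivity), mul_comm]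
  exact hU

theorem rank_eq_card (x : ℕ → ℝ) (n : ℕ) :
    rank x n = (Finset.univ.filter fun i : Fin n => x i < x n).card := by
  rw [rank, List.countP_eq_length_filter]
  rw [← List.toFinset_card_of_nodup (List.nodup_range.filter _)]
  rw [← Finset.card_map Fin.valEmbedding]
  congr 1
  ext i
  simp only [List.toFinset_filter, List.toFinset_range, Finset.mem_filter,
    Finset.mem_range, decide_eq_true_eq, Finset.mem_map, Finset.mem_univ, true_and,
    Fin.valEmbedding_apply]
  exact ⟨fun h => ⟨⟨i, h.1⟩, h.2, rfl⟩, by rintro ⟨j, h, rfl⟩; exact ⟨j.2, h⟩⟩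

theorem rank_le (x : ℕ → ℝ) (n : ℕ) : rank x n ≤ n := by
  simpa [rank] using List.countP_le_length (p := fun i => decide (x i < x n)) (l := List.range n)

/-- Ranks see only the relative order, here encoded by `σ`; a deterministic sequence with that order
can therefore replace the random one. -/
theorem rank_eq_of_strictMono {x y : ℕ → ℝ} {n : ℕ} {σ : Equiv.Perm (Fin n)}
    (hx : StrictMono fun i => x (σ i : Fin n)) (hy : StrictMono fun i => y (σ i : Fin n))
    {i : ℕ} (hi : i < n) : rank x i = rank y i := by
  rw [rank, rank]
  refine List.countP_congr fun j hj => ?_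
  rw [List.mem_range] at hj
  have h1 := hx.lt_iff_lt (a := σ.symm ⟨j, hj.trans hi⟩) (b := σ.symm ⟨i, hi⟩)
  have h2 := hy.lt_iff_lt (a := σ.symm ⟨j, hj.trans hi⟩) (b := σ.symm ⟨i, hi⟩)
  simp only [Equiv.apply_symm_apply] at h1 h2
  simp [h1, h2]

/-- Inserting `x n` at its rank into the increasing arrangement of the earlier terms gives an
increasing arrangement. -/
theorem strictMono_insertNth_iff {x : ℕ → ℝ} (hx : Function.Injective x) {n : ℕ}
    (σ : Equiv.Perm (Fin n)) (r : Fin (n + 1)) :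
    (StrictMono fun i => x ((Fin.insertNth r n (fun i => (σ i : ℕ)) : Fin (n + 1) → ℕ) i)) ↔
      (StrictMono fun i => x (σ i : Fin n)) ∧ rank x n = r := by
  have hcard : rank x n = (Finset.univ.filter fun i : Fin n => x (σ i : Fin n) < x n).card := by
    rw [rank_eq_card]
    refine (congrArg Finset.card ?_).trans (Finset.card_map σ.toEmbedding)
    ext i
    simp only [Finset.mem_filter, Finset.mem_univ, true_and, Finset.mem_map,
      Equiv.coe_toEmbedding]
    exact ⟨fun h => ⟨σ.symm i, by simpa using h, by simp⟩, by rintro ⟨j, h, rfl⟩; exact h⟩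
  have hlt : ∀ m : ℕ, m ≤ n →
      (Finset.univ.filter fun i : Fin n => (i : ℕ) < m).card = m := by
    intro m hm
    refine (Finset.card_map Fin.valEmbedding).symm.trans
      ((congrArg Finset.card ?_).trans (Finset.card_range m))
    · ext i
      simp only [Finset.mem_map, Finset.mem_filter, Finset.mem_univ, true_and,
        Fin.valEmbedding_apply, Finset.mem_range]
      exact ⟨by rintro ⟨j, h, rfl⟩; exact h, fun h => ⟨⟨i, by omega⟩, h, rfl⟩⟩
  have hne : ∀ i : Fin n, x (σ i : Fin n) ≠ x n := fun i h => by
    have := hx h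
    have := (σ i).2
    omega
  constructor
  · intro h
    refine ⟨fun i j hij => ?_, ?_⟩
    · simpa using h (r.strictMono_succAbove hij)
    · rw [hcard, ← hlt r (Nat.lt_succ_iff.1 r.2)]
      refine congrArg Finset.card (Finset.filter_congr fun i _ => ?_)
      have h1 := h.lt_iff_lt (a := r.succAbove i) (b := r)
      simp only [Fin.insertNth_apply_succAbove, Fin.insertNth_apply_same] at h1
      rw [h1, Fin.succAbove_lt_iff_castSucc_lt, Fin.lt_def, Fin.val_castSucc]
  · rintro ⟨h, hr⟩
    -- In increasing arrangement the terms below `x n` form an initial segment, whose length is the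
    -- rank.
    have hiff : ∀ i : Fin n, x (σ i : Fin n) < x n ↔ (i : ℕ) < r := by
      have hdown : ∀ i j : Fin n, i ≤ j → x (σ j : Fin n) < x n → x (σ i : Fin n) < x n :=
        fun i j hij hj => (h.monotone hij).trans_lt hj
      intro i
      constructor
      · intro hi
        by_contra hc
        have : (Finset.univ.filter fun j : Fin n => (j : ℕ) < i + 1).card ≤ rank x n := by
          rw [hcard]
          refine Finset.card_le_card fun j hj => ?_
          simp only [Finset.mem_filter, Finset.mem_univ, true_and] at hj ⊢
          exact hdown j i (by rw [Fin.le_def]; omega) hi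
        rw [hlt _ (by omega)] at this
        omega
      · intro hi
        by_contra hc
        have : rank x n ≤ (Finset.univ.filter fun j : Fin n => (j : ℕ) < i).card := by
          rw [hcard]
          refine Finset.card_le_card fun j hj => ?_
          simp only [Finset.mem_filter, Finset.mem_univ, true_and] at hj ⊢
          by_contra hji
          exact hc (hdown i j (by rw [Fin.le_def]; omega) hj)
        rw [hlt _ (by omega)] at this
        omega
    intro a b hab
    induction a using Fin.succAboveCases r with
    | x =>
      induction b using Fin.succAboveCases r with
      | x => exact absurd hab (lt_irrefl _)
      | p j =>
        simp only [Fin.insertNth_apply_succAbove, Fin.insertNth_apply_same]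
        refine lt_of_le_of_ne (not_lt.1 fun hc => ?_) (hne j).symm
        rw [hiff, ← Fin.val_castSucc, ← Fin.lt_def, ← Fin.succAbove_lt_iff_castSucc_lt] at hc
        exact lt_asymm hc hab
    | p i =>
      induction b using Fin.succAboveCases r with
      | x =>
        simp only [Fin.insertNth_apply_succAbove, Fin.insertNth_apply_same]
        rw [hiff, ← Fin.val_castSucc, ← Fin.lt_def, ← Fin.succAbove_lt_iff_castSucc_lt]
        exact hab
      | p j =>
        simp only [Fin.insertNth_apply_succAbove]
        exact h (r.strictMono_succAbove.lt_iff_lt.1 hab)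

theorem integral_eq_sum_of_partition {Ω ι : Type*} [MeasurableSpace Ω] {P : Measure Ω}
    [IsProbabilityMeasure P] [Fintype ι] {A : ι → Set Ω} (hA : ∀ i, MeasurableSet (A i))
    (hd : Pairwise (Function.onFun Disjoint A)) (hU : ∀ᵐ ω ∂P, ω ∈ ⋃ i, A i)
    {f : Ω → ℂ} {c : ι → ℂ} (hf : ∀ i, ∀ ω ∈ A i, f ω = c i) :
    ∫ ω, f ω ∂P = ∑ i, (P.real (A i) : ℂ) * c i := by
  have h1 : ∀ i, IntegrableOn f (A i) P := fun i =>
    (integrableOn_const (C := c i)).congr_fun (fun ω hω => (hf i ω hω).symm) (hA i)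
  rw [← setIntegral_univ, ← setIntegral_congr_set (s := ⋃ i, A i) (eventuallyEq_univ.2 hU),
    integral_iUnion_fintype hA hd h1]
  refine Finset.sum_congr rfl fun i _ => ?_
  rw [setIntegral_congr_fun (hA i) (hf i), setIntegral_const, Complex.real_smul]

theorem measurable_rank {Ω : Type*} [MeasurableSpace Ω] {ξ : ℕ → Ω → ℝ}
    (hmeas : ∀ n, Measurable (ξ n)) (n : ℕ) : Measurable fun ω => rank (fun i => ξ i ω) n := by
  simp only [rank_eq_card, Finset.card_filter]
  refine Finset.measurable_sum _ fun i _ => ?_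
  exact Measurable.ite (measurableSet_lt (hmeas _) (hmeas _)) measurable_const measurable_const

theorem injective_insertNth {n : ℕ} (σ : Equiv.Perm (Fin n)) (r : Fin (n + 1)) :
    Function.Injective (Fin.insertNth r n (fun i => (σ i : ℕ)) : Fin (n + 1) → ℕ) := by
  have hne : ∀ i, (σ i : ℕ) ≠ n := fun i => (σ i).2.ne
  intro a b hab
  induction a using Fin.succAboveCases r with
  | x =>
    induction b using Fin.succAboveCases r with
    | x => rfl
    | p j => simp [(hne j).symm] at hab
  | p i =>
    induction b using Fin.succAboveCases r with
    | x => simp [hne i] at hab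
    | p j =>
      simp only [Fin.insertNth_apply_succAbove] at hab
      rw [σ.injective (Fin.val_injective hab)]

/-! ### The recursion for the joint generating function -/

open Classical in
/-- The monomial in the depths of the paths `u l` at time `n`, restricted to the event that all
depths are at least `K` at time `m`. -/
noncomputable def restrictedMonomial {ι : Type*} [Fintype ι] (u : ι → ℕ → Bool) (K m : ℕ)
    (z : ι → ℂ) (ρ : ℕ → ℕ) (n : ℕ) : ℂ :=
  (if ∀ l, K ≤ (pathState (u l) ρ m).1 then 1 else 0) * ∏ l, z l ^ (pathState (u l) ρ n).1

/-- By injectivity at most one factor differs from one, so the product is linear in the `z l - 1`.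
-/
theorem prod_ite_eq_one_add_sum {ι : Type*} [Fintype ι] {j : ι → ℕ} (hj : Function.Injective j)
    (z : ι → ℂ) (c : ℕ) :
    ∏ l, (if c = j l then z l else 1) = 1 + ∑ l, (if c = j l then z l - 1 else 0) := by
  classical
  by_cases h : ∃ l, c = j l
  · obtain ⟨l, rfl⟩ := h
    simp [hj.eq_iff]
  · push Not at h
    simp [h]

/-- Depth at least `K` at time `m` persists and means that the paths have separated; their indices
are then distinct and at most one depth grows. -/
theorem restrictedMonomial_succ {ι : Type*} [Fintype ι] {u : ι → ℕ → Bool} {K : ℕ}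
    (hK : ∀ l l', l ≠ l' → ∃ i < K, u l i ≠ u l' i) (z : ι → ℂ) (ρ : ℕ → ℕ) {m n : ℕ}
    (hmn : m ≤ n) :
    restrictedMonomial u K m z ρ (n + 1) = restrictedMonomial u K m z ρ n *
      (1 + ∑ l, if ρ n = (pathState (u l) ρ n).2 then z l - 1 else 0) := by
  unfold restrictedMonomial
  split_ifs with h
  · have hj : Function.Injective fun l => (pathState (u l) ρ n).2 := by
      intro l l' hl
      by_contra hne
      obtain ⟨i, hi, hu⟩ := hK l l' hne
      exact pathState_snd_ne hu (hi.trans_le ((h l).trans (pathState_fst_mono (u l) ρ hmn))) hl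
    rw [← prod_ite_eq_one_add_sum hj, one_mul, one_mul, ← Finset.prod_mul_distrib]
    refine Finset.prod_congr rfl fun l _ => ?_
    simp only [pathState]
    split_ifs
    · rw [pow_succ]
    · rw [mul_one]
  · simp

/-- Independent, identically distributed real random variables without atoms. -/
structure IsIIDNoAtoms {Ω : Type*} [MeasurableSpace Ω] (P : Measure Ω) (ξ : ℕ → Ω → ℝ) :
    Prop where
  measurable : ∀ n, Measurable (ξ n)
  indep : iIndepFun ξ P
  map_eq : ∀ n, P.map (ξ n) = P.map (ξ 0)
  noAtoms : NullSingletonClass (P.map (ξ 0))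

namespace IsIIDNoAtoms

variable {Ω : Type*} [MeasurableSpace Ω] {P : Measure Ω} [IsProbabilityMeasure P]
  {ξ : ℕ → Ω → ℝ}

theorem ae_injective (h : IsIIDNoAtoms P ξ) : ∀ᵐ ω ∂P, Function.Injective fun n => ξ n ω :=
  Silhouette.ae_injective h.measurable h.indep fun n => (h.map_eq n).symm ▸ h.noAtoms

/-- Order of the first `n` terms plus the next rank amounts to an order of `n + 1` terms. As the
probability depends on neither `σ` nor `r`, the new rank is uniform and independent of the earlier
order. -/
theorem measureReal_strictMono_inter_rank (h : IsIIDNoAtoms P ξ) {n : ℕ}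
    (σ : Equiv.Perm (Fin n)) (r : Fin (n + 1)) :
    P.real ({ω | StrictMono fun i => ξ (σ i : Fin n) ω} ∩
      {ω | rank (fun i => ξ i ω) n = r}) = 1 / ((n + 1).factorial : ℝ) := by
  rw [← measureReal_strictMono h.measurable h.indep h.map_eq h.noAtoms _
    (injective_insertNth σ r)]
  refine measureReal_congr ?_
  filter_upwards [h.ae_injective] with ω hω
  exact propext (strictMono_insertNth_iff hω σ r).symm

/-- The values `c` are chosen before `G`, so that the same ones serve for evaluation at the next
rank and for the average over all ranks. -/
theorem integral_rank_eq_sum (h : IsIIDNoAtoms P ξ) {n : ℕ} (H : (ℕ → ℕ) → ℕ → ℂ)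
    (hH : ∀ ρ ρ' : ℕ → ℕ, (∀ i < n, ρ i = ρ' i) → H ρ = H ρ') :
    ∃ c : Equiv.Perm (Fin n) → ℕ → ℂ,
      ∀ G : (ℕ → ℂ) → ℕ → ℂ, ∫ ω, G (H (rank fun i => ξ i ω)) (rank (fun i => ξ i ω) n) ∂P =
        ∑ p : Equiv.Perm (Fin n) × Fin (n + 1), (1 / ((n + 1).factorial : ℝ) : ℝ) *
          G (c p.1) p.2 := by
  -- A representative of the order `σ`: term `i` is its position in the arrangement. The value `0`
  -- beyond `n` is irrelevant, as `H` sees only the first `n` ranks.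
  let y : Equiv.Perm (Fin n) → ℕ → ℝ := fun σ i =>
    if hi : i < n then ((σ.symm ⟨i, hi⟩ : Fin n) : ℕ) else 0
  have hy : ∀ σ : Equiv.Perm (Fin n), StrictMono fun i => y σ (σ i : Fin n) := by
    intro σ i j hij
    simpa [y] using hij
  refine ⟨fun σ => H (rank (y σ)), fun G => ?_⟩
  let A : Equiv.Perm (Fin n) × Fin (n + 1) → Set Ω := fun p =>
    {ω | StrictMono fun i => ξ (p.1 i : Fin n) ω} ∩ {ω | rank (fun i => ξ i ω) n = p.2}
  have hA : ∀ p, MeasurableSet (A p) := fun p =>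
    ((measurable_pi_lambda (fun ω (i : Fin n) => ξ (p.1 i : Fin n) ω) fun i => h.measurable _)
      (measurableSet_strictMono_fin n)).inter
      (measurable_rank h.measurable n (measurableSet_singleton (p.2 : ℕ)))
  have hd : Pairwise (Function.onFun Disjoint A) := by
    intro p q hpq
    refine Set.disjoint_left.2 fun ω h1 h2 => hpq ?_
    have h3 : p.1 = q.1 := perm_eq_of_strictMono (f := fun i : Fin n => ξ i ω) h1.1 h2.1
    have h4 : (p.2 : ℕ) = q.2 := h1.2.symm.trans h2.2
    exact Prod.ext h3 (Fin.ext h4)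
  have hU : ∀ᵐ ω ∂P, ω ∈ ⋃ p, A p := by
    filter_upwards [h.ae_injective] with ω hω
    refine Set.mem_iUnion.2 ⟨(Tuple.sort fun i : Fin n => ξ i ω,
      ⟨rank (fun i => ξ i ω) n, Nat.lt_succ_of_le (rank_le _ n)⟩), ?_, rfl⟩
    refine (Tuple.monotone_sort fun i : Fin n => ξ i ω).strictMono_of_injective ?_
    exact (Function.Injective.comp hω Fin.val_injective).comp (Equiv.injective _)
  rw [integral_eq_sum_of_partition hA hd hU (c := fun p => G (H (rank (y p.1))) p.2)]
  · refine Finset.sum_congr rfl fun p _ => ?_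
    rw [h.measureReal_strictMono_inter_rank]
  · rintro p ω ⟨h1, h2⟩
    have h3 : H (rank fun i => ξ i ω) = H (rank (y p.1)) :=
      hH _ _ fun i hi => rank_eq_of_strictMono (x := fun j => ξ j ω) h1 (hy p.1) hi
    have h2' : rank (fun i => ξ i ω) n = p.2 := h2
    rw [h3, h2']

/-- Given the first `n` ranks, the next one is uniformly distributed on `{0, …, n}`. -/
theorem integral_rank (h : IsIIDNoAtoms P ξ) {n : ℕ} (H : (ℕ → ℕ) → ℕ → ℂ)
    (hH : ∀ ρ ρ' : ℕ → ℕ, (∀ i < n, ρ i = ρ' i) → H ρ = H ρ') :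
    ∫ ω, H (rank fun i => ξ i ω) (rank (fun i => ξ i ω) n) ∂P =
      ∫ ω, (∑ r ∈ Finset.range (n + 1), H (rank fun i => ξ i ω) r) / (n + 1) ∂P := by
  obtain ⟨c, hc⟩ := h.integral_rank_eq_sum H hH
  rw [hc fun f r => f r, hc fun f _ => (∑ r ∈ Finset.range (n + 1), f r) / (n + 1),
    Fintype.sum_prod_type, Fintype.sum_prod_type]
  refine Finset.sum_congr rfl fun σ _ => ?_
  have : ((n : ℂ) + 1) ≠ 0 := by exact_mod_cast n.succ_ne_zero
  simp only [← Finset.mul_sum, Finset.sum_const, Finset.card_univ, Fintype.card_fin, nsmul_eq_mul,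
    Finset.sum_range]
  push_cast
  field_simp

variable {ι : Type*} [Fintype ι]

/-- Each index lies in `{0, …, n}`, so a uniform rank hits it with conditional probability `1 / (n +
1)`. -/
theorem integral_restrictedMonomial_succ (h : IsIIDNoAtoms P ξ) {u : ι → ℕ → Bool} {K : ℕ}
    (hK : ∀ l l', l ≠ l' → ∃ i < K, u l i ≠ u l' i) (z : ι → ℂ) {m n : ℕ} (hmn : m ≤ n) :
    ∫ ω, restrictedMonomial u K m z (rank fun i => ξ i ω) (n + 1) ∂P =
      (∫ ω, restrictedMonomial u K m z (rank fun i => ξ i ω) n ∂P) *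
        (1 + (∑ l, (z l - 1)) / (n + 1)) := by
  have hn : ((n : ℂ) + 1) ≠ 0 := by exact_mod_cast n.succ_ne_zero
  simp only [restrictedMonomial_succ hK z _ hmn]
  rw [← integral_mul_const]
  rw [h.integral_rank (fun ρ r => restrictedMonomial u K m z ρ n *
      (1 + ∑ l, if r = (pathState (u l) ρ n).2 then z l - 1 else 0)) ?_]
  · refine integral_congr_ae (Eventually.of_forall fun ω => ?_)
    have hr : ∀ l, (pathState (u l) (rank fun i => ξ i ω) n).2 ∈ Finset.range (n + 1) := fun l =>
      Finset.mem_range.2 (Nat.lt_succ_of_le (pathState_snd_le _ _ _))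
    simp only [← Finset.mul_sum, Finset.sum_add_distrib]
    rw [Finset.sum_comm]
    simp only [Finset.sum_ite_eq', hr, if_true, Finset.sum_const, Finset.card_range, nsmul_eq_mul]
    push_cast
    field_simp
  · intro ρ ρ' hρ
    have h1 : ∀ l, pathState (u l) ρ n = pathState (u l) ρ' n := fun l => pathState_congr _ hρ
    have h2 : ∀ l, pathState (u l) ρ m = pathState (u l) ρ' m := fun l =>
      pathState_congr _ fun i hi => hρ i (hi.trans_le hmn)
    simp only [restrictedMonomial, h1, h2]

theorem integral_restrictedMonomial (h : IsIIDNoAtoms P ξ) {u : ι → ℕ → Bool} {K : ℕ}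
    (hK : ∀ l l', l ≠ l' → ∃ i < K, u l i ≠ u l' i) (z : ι → ℂ) {m n : ℕ} (hmn : m ≤ n) :
    ∫ ω, restrictedMonomial u K m z (rank fun i => ξ i ω) n ∂P =
      (∫ ω, restrictedMonomial u K m z (rank fun i => ξ i ω) m ∂P) *
        ∏ k ∈ Finset.Ico m n, (1 + (∑ l, (z l - 1)) / (k + 1)) := by
  induction n, hmn using Nat.le_induction with
  | base => simp
  | succ n hmn ih =>
    rw [h.integral_restrictedMonomial_succ hK z hmn, ih, Finset.prod_Ico_succ_top hmn, mul_assoc]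

end IsIIDNoAtoms

/-! ### Asymptotics of the products -/

theorem tendsto_exp_sub_one_mul {α : Type*} {l : Filter α} {L : α → ℝ} (hL : Tendsto L l atTop)
    (θ : ℝ) :
    Tendsto (fun n => (Complex.exp ((θ / √(L n) : ℝ) * Complex.I) - 1) * L n -
      (θ * √(L n) : ℝ) * Complex.I) l (𝓝 (-(θ : ℂ) ^ 2 / 2)) := by
  have hs : Tendsto (fun n => √(L n)) l atTop := Real.tendsto_sqrt_atTop.comp hL
  have hx : Tendsto (fun n => |θ| / √(L n)) l (𝓝 0) := hs.const_div_atTop _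
  have hx2 : Tendsto (fun n => θ ^ 2 * (|θ| / √(L n))) l (𝓝 0) := by simpa using hx.const_mul (θ ^ 2)
  rw [tendsto_iff_norm_sub_tendsto_zero]
  refine squeeze_zero' (Eventually.of_forall fun _ => norm_nonneg _) ?_ hx2
  filter_upwards [hx.eventually (gt_mem_nhds zero_lt_one), hL.eventually_gt_atTop 0] with n h1 h0
  have hs0 : 0 < √(L n) := Real.sqrt_pos.2 h0
  have hLs : L n = √(L n) ^ 2 := (Real.sq_sqrt h0.le).symm
  set r := √(L n) with hr
  set x : ℂ := (θ / r : ℝ) * Complex.I with hxdef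
  have hxn : ‖x‖ = |θ| / r := by
    rw [hxdef, norm_mul, Complex.norm_I, mul_one, Complex.norm_real, Real.norm_eq_abs, abs_div,
      abs_of_pos hs0]
  -- Second-order Taylor expansion: the remainder is at most `4 / 18 * ‖x‖ ^ 3`, which after
  -- multiplication by `L n` is of order `1 / √(L n)`.
  have hb := Complex.exp_bound (x := x) (hxn ▸ h1.le) (n := 3) (by norm_num)
  have hrc : (r : ℂ) ≠ 0 := by exact_mod_cast hs0.ne'
  have e : (Complex.exp x - 1) * (L n : ℂ) - (θ * r : ℝ) * Complex.I - -(θ : ℂ) ^ 2 / 2 =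
      (Complex.exp x - ∑ m ∈ Finset.range 3, x ^ m / (m.factorial : ℂ)) * (r : ℂ) ^ 2 := by
    rw [hLs]
    simp only [Finset.sum_range_succ, Finset.sum_range_zero, hxdef, Nat.factorial]
    push_cast
    field_simp
    ring_nf
    simp only [Complex.I_sq]
    ring
  rw [e, norm_mul, norm_pow, Complex.norm_real, Real.norm_eq_abs, abs_of_pos hs0]
  calc _ ≤ (‖x‖ ^ 3 * ((Nat.succ 3 : ℕ) * ((Nat.factorial 3 : ℕ) * (3 : ℕ) : ℝ)⁻¹)) * r ^ 2 := by
        gcongr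
    _ ≤ (‖x‖ ^ 3 * 1) * r ^ 2 := by
        gcongr
        norm_num [Nat.factorial]
    _ = θ ^ 2 * (|θ| / r) := by
        rw [hxn, ← sq_abs θ]
        field_simp

theorem tendsto_sum_Ico_sub_log (m : ℕ) :
    Tendsto (fun n : ℕ => ∑ k ∈ Finset.Ico m n, (1 : ℝ) / (k + 1) - Real.log n) atTop
      (𝓝 (Real.eulerMascheroniConstant - harmonic m)) := by
  refine (Real.tendsto_harmonic_sub_log.sub_const _).congr' ?_
  filter_upwards [eventually_ge_atTop m] with n hn
  rw [Finset.sum_Ico_eq_sub _ hn]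
  simp only [harmonic, one_div]
  push_cast
  ring

/-- Take logarithms: the error of `log (1 + w) ≈ w` sums to `O(‖c n‖²)`, and the harmonic sum
differs from `log n` by a convergent quantity, which the factor `c n → 0` kills. -/
theorem tendsto_prod_one_add_div {c a : ℕ → ℂ} {b : ℂ} (m : ℕ) (hc : Tendsto c atTop (𝓝 0))
    (hca : Tendsto (fun n => c n * Real.log n - a n) atTop (𝓝 b)) :
    Tendsto (fun n => (∏ k ∈ Finset.Ico m n, (1 + c n / (k + 1))) * Complex.exp (-a n)) atTop
      (𝓝 (Complex.exp b)) := by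
  have hsum : Summable fun k : ℕ => (1 : ℝ) / (k + 1) ^ 2 := by
    have := (summable_nat_add_iff 1).2 (Real.summable_one_div_nat_pow.2 (one_lt_two))
    simpa using this
  set C := ∑' k : ℕ, (1 : ℝ) / (k + 1) ^ 2
  have hlt : ∀ n k, ‖c n‖ ≤ 1 / 2 → ‖c n / ((k : ℕ) + 1 : ℂ)‖ ≤ 1 / 2 ∧
      ‖c n / ((k : ℕ) + 1 : ℂ)‖ ^ 2 = ‖c n‖ ^ 2 * (1 / ((k : ℝ) + 1) ^ 2) := by
    intro n k h
    have : ‖((k : ℕ) + 1 : ℂ)‖ = (k : ℝ) + 1 := by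
      have := Complex.norm_natCast (k + 1)
      push_cast at this
      exact this
    rw [norm_div, this]
    constructor
    · exact (div_le_self (norm_nonneg _) (by linarith [(k.cast_nonneg : (0 : ℝ) ≤ k)])).trans h
    · field_simp
  have hsmall : ∀ᶠ n in atTop, ‖c n‖ ≤ 1 / 2 := by
    have := hc.norm
    rw [norm_zero] at this
    exact this.eventually (ge_mem_nhds (by norm_num))
  have hrem : Tendsto (fun n => ∑ k ∈ Finset.Ico m n,
      (Complex.log (1 + c n / (k + 1)) - c n / (k + 1))) atTop (𝓝 0) := by
    have h0 : Tendsto (fun n => ‖c n‖ ^ 2 * C) atTop (𝓝 0) := by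
      simpa using (hc.norm.pow 2).mul_const C
    refine squeeze_zero_norm' ?_ h0
    filter_upwards [hsmall] with n hn
    calc _ ≤ ∑ k ∈ Finset.Ico m n, ‖c n‖ ^ 2 * (1 / ((k : ℝ) + 1) ^ 2) := by
          refine norm_sum_le_of_le _ fun k _ => ?_
          obtain ⟨h1, h2⟩ := hlt n k hn
          refine (Complex.norm_log_one_add_sub_self_le (h1.trans_lt (by norm_num))).trans ?_
          rw [← h2]
          have : (1 - ‖c n / ((k : ℕ) + 1 : ℂ)‖)⁻¹ ≤ 2 := by
            rw [inv_le_comm₀ (by linarith) (by norm_num)]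
            linarith
          nlinarith [sq_nonneg ‖c n / ((k : ℕ) + 1 : ℂ)‖]
      _ ≤ ‖c n‖ ^ 2 * C := by
          rw [← Finset.mul_sum]
          gcongr
          exact hsum.sum_le_tsum _ fun _ _ => by positivity
  have hharm : Tendsto (fun n => c n * ((∑ k ∈ Finset.Ico m n, (1 : ℝ) / (k + 1) - Real.log n : ℝ) : ℂ))
      atTop (𝓝 0) := by
    simpa using hc.mul ((Complex.continuous_ofReal.tendsto _).comp (tendsto_sum_Ico_sub_log m))
  have hexp := (Complex.continuous_exp.tendsto _).comp ((hrem.add hharm).add hca)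
  rw [zero_add, zero_add] at hexp
  refine hexp.congr' ?_
  filter_upwards [hsmall] with n hn
  have hprod : ∏ k ∈ Finset.Ico m n, (1 + c n / ((k : ℂ) + 1)) =
      Complex.exp (∑ k ∈ Finset.Ico m n, Complex.log (1 + c n / (k + 1))) := by
    rw [Complex.exp_sum]
    refine Finset.prod_congr rfl fun k _ => (Complex.exp_log fun h0 => ?_).symm
    have h1 : c n / ((k : ℂ) + 1) = -1 := by linear_combination h0
    have := (hlt n k hn).1
    rw [h1] at this
    norm_num at this
  rw [hprod, ← Complex.exp_add]
  simp only [Function.comp]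
  congr 1
  push_cast
  simp only [Finset.sum_sub_distrib, div_eq_mul_inv, ← Finset.mul_sum, one_mul]
  ring

/-- This product is the mean of `(1 / 2) ^ depth` for one path; `1 - x ≤ exp (-x)` and the divergent
harmonic series send it to zero. -/
theorem tendsto_prod_one_sub_half_div :
    Tendsto (fun n : ℕ => ∏ k ∈ Finset.range n, (1 + ((1 : ℂ) / 2 - 1) / (k + 1))) atTop (𝓝 0) := by
  have h0 : Tendsto (fun n : ℕ => Real.exp (-(1 / 2) * ∑ k ∈ Finset.range n, (1 : ℝ) / (k + 1)))
      atTop (𝓝 0) :=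
    Real.tendsto_exp_atBot.comp
      (Real.tendsto_sum_range_one_div_nat_succ_atTop.const_mul_atTop_of_neg (by norm_num))
  refine squeeze_zero_norm (fun n => ?_) h0
  rw [norm_prod, Finset.mul_sum, Real.exp_sum]
  refine Finset.prod_le_prod (fun _ _ => norm_nonneg _) fun k _ => ?_
  have hk : (0 : ℝ) ≤ k := k.cast_nonneg
  have e : (1 : ℂ) + (1 / 2 - 1) / (k + 1) = ((1 + -(1 / 2) * (1 / (k + 1)) : ℝ) : ℂ) := by
    push_cast; ring
  have hle : (1 : ℝ) / (k + 1) ≤ 1 := by rw [div_le_one (by linarith)]; linarith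
  rw [e, Complex.norm_real, Real.norm_of_nonneg (by linarith), add_comm]
  exact Real.add_one_le_exp _

/-! ### Separation in probability and the characteristic function limit -/

theorem measurable_pathState {Ω : Type*} [MeasurableSpace Ω] {ξ : ℕ → Ω → ℝ}
    (hmeas : ∀ n, Measurable (ξ n)) (u : ℕ → Bool) (n : ℕ) :
    Measurable fun ω => pathState u (rank fun i => ξ i ω) n := by
  induction n with
  | zero => exact measurable_const
  | succ n ih =>
    exact (Measurable.of_discrete (f := fun q : ℕ × (ℕ × ℕ) =>
      (if q.1 = q.2.2 then q.2.1 + 1 else q.2.1,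
        if q.1 < q.2.2 ∨ q.1 = q.2.2 ∧ u q.2.1 = true then q.2.2 + 1 else q.2.2))).comp
      ((measurable_rank hmeas n).prodMk ih)

theorem exists_separation {ι : Type*} [Finite ι] {u : ι → ℕ → Bool} (hu : Function.Injective u) :
    ∃ K, ∀ l l', l ≠ l' → ∃ i < K, u l i ≠ u l' i := by
  cases nonempty_fintype ι
  have : ∀ p : ι × ι, ∃ i, p.1 ≠ p.2 → u p.1 i ≠ u p.2 i := by
    intro p
    by_cases h : p.1 = p.2
    · exact ⟨0, fun h' => absurd h h'⟩
    · obtain ⟨i, hi⟩ := Function.ne_iff.1 (hu.ne h)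
      exact ⟨i, fun _ => hi⟩
  choose i hi using this
  exact ⟨Finset.univ.sup i + 1, fun l l' h => ⟨i (l, l'),
    Nat.lt_succ_of_le (Finset.le_sup (Finset.mem_univ _)), hi (l, l') h⟩⟩

/-- The event that at time `m` all the paths `u l` have at least `K` nodes. -/
def deepEvent {Ω ι : Type*} (ξ : ℕ → Ω → ℝ) (u : ι → ℕ → Bool) (K m : ℕ) : Set Ω :=
  {ω | ∀ l, K ≤ (pathState (u l) (rank fun i => ξ i ω) m).1}

namespace IsIIDNoAtoms

variable {Ω : Type*} [MeasurableSpace Ω] {P : Measure Ω}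
  {ξ : ℕ → Ω → ℝ}

/-- Markov's inequality for `(1 / 2) ^ depth`, whose mean is known exactly and tends to zero. -/
theorem tendsto_measureReal_depth_lt [IsProbabilityMeasure P]
    (h : IsIIDNoAtoms P ξ) (u : ℕ → Bool) (K : ℕ) :
    Tendsto (fun n => P.real {ω | (pathState u (rank fun i => ξ i ω) n).1 < K}) atTop (𝓝 0) := by
  have hm := fun n => (measurable_pathState h.measurable u n).fst
  have hint : ∀ n, ((∫ ω, (1 / 2 : ℝ) ^ (pathState u (rank fun i => ξ i ω) n).1 ∂P : ℝ) : ℂ) =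
      ∏ k ∈ Finset.range n, (1 + ((1 : ℂ) / 2 - 1) / (k + 1)) := by
    intro n
    -- For a single path separation is vacuous, and `K = 0` removes the restriction.
    have := h.integral_restrictedMonomial (u := fun _ : Unit => u) (K := 0)
      (fun l l' hl => absurd rfl hl) (fun _ => 1 / 2) (Nat.zero_le n)
    simp only [restrictedMonomial, zero_le, implies_true, if_true, one_mul, Finset.univ_unique,
      Finset.prod_singleton, Finset.sum_singleton, pathState, pow_zero, integral_const,
      probReal_univ, one_smul, Nat.Ico_zero_eq_range] at this
    rw [← this, ← integral_complex_ofReal]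
    push_cast
    rfl
  have h0 : Tendsto (fun n => ∫ ω, (1 / 2 : ℝ) ^ (pathState u (rank fun i => ξ i ω) n).1 ∂P)
      atTop (𝓝 0) := by
    have := tendsto_prod_one_sub_half_div
    simp only [← hint] at this
    refine ((Complex.continuous_re.tendsto _).comp this).congr fun n => ?_
    simp only [Function.comp, Complex.ofReal_re]
  refine squeeze_zero (fun _ => measureReal_nonneg) (fun n => ?_)
    (by simpa only [mul_zero] using h0.const_mul ((2 : ℝ) ^ K))
  have hb : ∀ j : ℕ, (1 / 2 : ℝ) ^ j ≤ 1 := fun j => pow_le_one₀ (by norm_num) (by norm_num)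
  have hi : Integrable (fun ω => (1 / 2 : ℝ) ^ (pathState u (rank fun i => ξ i ω) n).1) P := by
    refine Integrable.of_bound (C := 1)
      ((Measurable.of_discrete (f := fun j : ℕ => (1 / 2 : ℝ) ^ j)).comp
        (hm n)).aestronglyMeasurable (Eventually.of_forall fun ω => ?_)
    rw [Real.norm_of_nonneg (by positivity)]
    exact hb _
  have hmk := mul_meas_ge_le_integral_of_nonneg (Eventually.of_forall fun ω => by positivity) hi
    ((1 / 2 : ℝ) ^ K)
  have hsub : P.real {ω | (pathState u (rank fun i => ξ i ω) n).1 < K} ≤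
      P.real {ω | (1 / 2 : ℝ) ^ K ≤ (1 / 2 : ℝ) ^ (pathState u (rank fun i => ξ i ω) n).1} :=
    measureReal_mono fun ω hω =>
      pow_le_pow_of_le_one (a := (1 / 2 : ℝ)) (by norm_num) (by norm_num) (le_of_lt hω)
  calc _ ≤ (2 : ℝ) ^ K * ((1 / 2 : ℝ) ^ K * _) := by
        rw [← mul_assoc, ← mul_pow]
        norm_num
        simpa using hsub
    _ ≤ _ := mul_le_mul_of_nonneg_left hmk (by positivity)

variable {ι : Type*} [Fintype ι]

theorem measurableSet_deepEvent (h : IsIIDNoAtoms P ξ) (u : ι → ℕ → Bool) (K m : ℕ) :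
    MeasurableSet (deepEvent ξ u K m) := by
  have : deepEvent ξ u K m = ⋂ l, {ω | K ≤ (pathState (u l) (rank fun i => ξ i ω) m).1} := by
    ext ω
    rw [Set.mem_iInter]
    rfl
  rw [this]
  exact MeasurableSet.iInter fun l =>
    measurableSet_le measurable_const (measurable_pathState h.measurable (u l) m).fst

theorem tendsto_measureReal_deepEvent_compl [IsProbabilityMeasure P]
    (h : IsIIDNoAtoms P ξ) (u : ι → ℕ → Bool) (K : ℕ) :
    Tendsto (fun m => P.real (deepEvent ξ u K m)ᶜ) atTop (𝓝 0) := by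
  have h0 := tendsto_finsetSum Finset.univ
    fun l _ => h.tendsto_measureReal_depth_lt (u l) K
  rw [Finset.sum_const_zero] at h0
  refine squeeze_zero (fun _ => measureReal_nonneg) (fun m => ?_) h0
  refine (measureReal_mono (fun ω hω => ?_)).trans (measureReal_iUnion_fintype_le _)
  by_contra hc
  refine hω fun l => not_lt.1 fun hl => hc (Set.mem_iUnion.2 ⟨l, hl⟩)

theorem integral_restrictedMonomial_eq (h : IsIIDNoAtoms P ξ) (u : ι → ℕ → Bool) (K m : ℕ)
    (z : ι → ℂ) (n : ℕ) :
    ∫ ω, restrictedMonomial u K m z (rank fun i => ξ i ω) n ∂P =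
      ∫ ω in deepEvent ξ u K m, ∏ l, z l ^ (pathState (u l) (rank fun i => ξ i ω) n).1 ∂P := by
  classical
  rw [← integral_indicator (h.measurableSet_deepEvent u K m)]
  refine integral_congr_ae (Eventually.of_forall fun ω => ?_)
  simp only [restrictedMonomial]
  rw [Set.indicator_apply, ite_mul, one_mul, zero_mul]
  exact if_congr Iff.rfl rfl rfl

theorem measurable_monomial (h : IsIIDNoAtoms P ξ) (u : ι → ℕ → Bool) (z : ι → ℂ) (n : ℕ) :
    Measurable fun ω => ∏ l, z l ^ (pathState (u l) (rank fun i => ξ i ω) n).1 :=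
  Finset.measurable_prod _ fun l _ => (Measurable.of_discrete (f := fun j : ℕ => z l ^ j)).comp
    (measurable_pathState h.measurable (u l) n).fst

/-- The monomial has modulus one, so restricting it costs at most the probability of the discarded
event. -/
theorem norm_integral_monomial_sub_le [IsProbabilityMeasure P]
    (h : IsIIDNoAtoms P ξ) (u : ι → ℕ → Bool) (K m : ℕ)
    {z : ι → ℂ} (hz : ∀ l, ‖z l‖ = 1) (n : ℕ) :
    ‖(∫ ω, ∏ l, z l ^ (pathState (u l) (rank fun i => ξ i ω) n).1 ∂P) -
      ∫ ω, restrictedMonomial u K m z (rank fun i => ξ i ω) n ∂P‖ ≤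
      P.real (deepEvent ξ u K m)ᶜ := by
  have hn : ∀ ω, ‖∏ l, z l ^ (pathState (u l) (rank fun i => ξ i ω) n).1‖ = 1 := by
    intro ω; simp [norm_prod, hz]
  have hi : Integrable (fun ω => ∏ l, z l ^ (pathState (u l) (rank fun i => ξ i ω) n).1) P :=
    Integrable.of_bound (C := 1) (h.measurable_monomial u z n).aestronglyMeasurable
      (Eventually.of_forall fun ω => (hn ω).le)
  rw [h.integral_restrictedMonomial_eq, ← integral_add_compl (h.measurableSet_deepEvent u K m) hi,
    add_sub_cancel_left]
  simpa using norm_setIntegral_le_of_norm_le_const (measure_lt_top P (deepEvent ξ u K m)ᶜ)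
    (fun ω _ => (hn ω).le)

/-- At the fixed time `m` the exponents do not change with `n`, so `z n → 1` and dominated
convergence suffice. -/
theorem tendsto_integral_restrictedMonomial_self [IsProbabilityMeasure P]
    (h : IsIIDNoAtoms P ξ) (u : ι → ℕ → Bool)
    (K m : ℕ) {z : ℕ → ι → ℂ} (hz : ∀ n l, ‖z n l‖ = 1)
    (hz1 : ∀ l, Tendsto (fun n => z n l) atTop (𝓝 1)) :
    Tendsto (fun n => ∫ ω, restrictedMonomial u K m (z n) (rank fun i => ξ i ω) m ∂P) atTop
      (𝓝 (P.real (deepEvent ξ u K m))) := by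
  simp only [h.integral_restrictedMonomial_eq]
  have hlim : ((P.real (deepEvent ξ u K m) : ℝ) : ℂ) = ∫ ω in deepEvent ξ u K m, (1 : ℂ) ∂P := by
    simp
  rw [hlim]
  refine tendsto_integral_of_dominated_convergence (fun _ => 1)
    (fun n => (h.measurable_monomial u (z n) m).aestronglyMeasurable) (integrable_const _)
    (fun n => Eventually.of_forall fun ω => by simp [norm_prod, hz]) (Eventually.of_forall fun ω => ?_)
  have := tendsto_finsetProd Finset.univ
    fun l _ => (hz1 l).pow (pathState (u l) (rank fun i => ξ i ω) m).1
  simpa using this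

/-- The characteristic function of the standardized depths of distinct paths converges to that of
the standard normal law. -/
theorem tendsto_integral_monomial [IsProbabilityMeasure P]
    (h : IsIIDNoAtoms P ξ) {u : ι → ℕ → Bool}
    (hu : Function.Injective u) (θ : ι → ℝ) :
    Tendsto (fun n : ℕ => (∫ ω, ∏ l, Complex.exp ((θ l / √(Real.log n) : ℝ) * Complex.I) ^
        (pathState (u l) (rank fun i => ξ i ω) n).1 ∂P) *
      Complex.exp (-∑ l, (θ l * √(Real.log n) : ℝ) * Complex.I)) atTop
      (𝓝 (Complex.exp (∑ l, -(θ l : ℂ) ^ 2 / 2))) := by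
  obtain ⟨K, hK⟩ := exists_separation hu
  have hL : Tendsto (fun n : ℕ => Real.log n) atTop atTop :=
    Real.tendsto_log_atTop.comp tendsto_natCast_atTop_atTop
  set z : ℕ → ι → ℂ := fun n l => Complex.exp ((θ l / √(Real.log n) : ℝ) * Complex.I) with hzdef
  set a : ℕ → ℂ := fun n => ∑ l, (θ l * √(Real.log n) : ℝ) * Complex.I with hadef
  set g : ℂ := Complex.exp (∑ l, -(θ l : ℂ) ^ 2 / 2) with hg
  have hz : ∀ n l, ‖z n l‖ = 1 := fun n l => Complex.norm_exp_ofReal_mul_I _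
  have ha : ∀ n, ‖Complex.exp (-a n)‖ = 1 := by
    intro n
    have : -a n = ((-∑ l, θ l * √(Real.log n) : ℝ) : ℂ) * Complex.I := by
      simp only [hadef]
      push_cast
      rw [← Finset.sum_mul, neg_mul]
    rw [this]
    exact Complex.norm_exp_ofReal_mul_I _
  have hz1 : ∀ l, Tendsto (fun n => z n l) atTop (𝓝 1) := by
    intro l
    have h1 : Tendsto (fun n : ℕ => θ l / √(Real.log n)) atTop (𝓝 0) :=
      (Real.tendsto_sqrt_atTop.comp hL).const_div_atTop _
    have h2 := (Complex.continuous_exp.tendsto _).comp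
      (((Complex.continuous_ofReal.tendsto _).comp h1).mul_const Complex.I)
    simpa [Function.comp_def, hzdef] using h2
  have hc : Tendsto (fun n => ∑ l, (z n l - 1)) atTop (𝓝 0) := by
    have := tendsto_finsetSum Finset.univ fun l _ => (hz1 l).sub_const 1
    simpa using this
  have hca : Tendsto (fun n => (∑ l, (z n l - 1)) * Real.log n - a n) atTop
      (𝓝 (∑ l, -(θ l : ℂ) ^ 2 / 2)) := by
    have := tendsto_finsetSum Finset.univ fun l _ => tendsto_exp_sub_one_mul hL (θ l)
    refine this.congr fun n => ?_
    simp only [Finset.sum_sub_distrib, ← Finset.sum_mul, hadef, hzdef]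
  have hψ : ∀ m, Tendsto (fun n =>
      (∫ ω, restrictedMonomial u K m (z n) (rank fun i => ξ i ω) n ∂P) * Complex.exp (-a n)) atTop
      (𝓝 (P.real (deepEvent ξ u K m) * g)) := by
    intro m
    refine ((h.tendsto_integral_restrictedMonomial_self u K m hz hz1).mul
      (tendsto_prod_one_add_div m hc hca)).congr' ?_
    filter_upwards [eventually_ge_atTop m] with n hn
    rw [h.integral_restrictedMonomial hK (z n) hn, mul_assoc]
  rw [Metric.tendsto_atTop']
  intro ε hε
  -- The discarded event enters twice: as the restriction error and, times `‖g‖`, in the limit. So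
  -- `m` is fixed from `ε` first, and only then `n → ∞`.
  have hq := (h.tendsto_measureReal_deepEvent_compl u K).mul_const (1 + ‖g‖)
  rw [zero_mul] at hq
  obtain ⟨m, hm⟩ := (hq.eventually (gt_mem_nhds (half_pos hε))).exists
  have hev := Metric.tendsto_nhds.1 (hψ m) (ε / 2) (half_pos hε)
  obtain ⟨N, hN⟩ := eventually_atTop.1 hev
  refine ⟨N, fun n hn => ?_⟩
  have h1 := hN n hn.le
  have h2 := h.norm_integral_monomial_sub_le u K m (hz n) n
  rw [dist_eq_norm] at h1 ⊢
  set φ := ∫ ω, ∏ l, z n l ^ (pathState (u l) (rank fun i => ξ i ω) n).1 ∂P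
  set ψ := ∫ ω, restrictedMonomial u K m (z n) (rank fun i => ξ i ω) n ∂P
  have hp : (P.real (deepEvent ξ u K m) : ℂ) = 1 - P.real (deepEvent ξ u K m)ᶜ := by
    rw [probReal_compl_eq_one_sub (h.measurableSet_deepEvent u K m)]
    push_cast; ring
  have e : φ * Complex.exp (-a n) - g = (φ - ψ) * Complex.exp (-a n) +
      (ψ * Complex.exp (-a n) - P.real (deepEvent ξ u K m) * g) -
        P.real (deepEvent ξ u K m)ᶜ * g := by
    rw [hp]; ring
  rw [e]
  calc _ ≤ ‖(φ - ψ) * Complex.exp (-a n)‖ +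
        ‖ψ * Complex.exp (-a n) - P.real (deepEvent ξ u K m) * g‖ +
        ‖(P.real (deepEvent ξ u K m)ᶜ : ℂ) * g‖ :=
        (norm_sub_le _ _).trans (add_le_add_left (norm_add_le _ _) _)
    _ < P.real (deepEvent ξ u K m)ᶜ + ε / 2 + P.real (deepEvent ξ u K m)ᶜ * ‖g‖ := by
        rw [norm_mul, ha, mul_one, norm_mul, Complex.norm_real,
          Real.norm_of_nonneg measureReal_nonneg]
        linarith
    _ < ε := by linarith

end IsIIDNoAtoms

theorem IsIIDNoAtoms.of_uniform {Ω : Type*} [MeasurableSpace Ω] {P : Measure Ω}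
    {ξ : ℕ → Ω → ℝ} (hmeas : ∀ n, Measurable (ξ n)) (hindep : iIndepFun ξ P)
    (hunif : ∀ n, pdf.IsUniform (ξ n) (Set.Icc 0 1) P volume) : IsIIDNoAtoms P ξ where
  measurable := hmeas
  indep := hindep
  map_eq n := (hunif n).trans (hunif 0).symm
  noAtoms := ⟨fun x => (hunif 0).absolutelyContinuous (measure_singleton x)⟩

/-! ### Gaussian measure of orthants -/

/-- The points of a Euclidean space whose coordinates in `S` do not exceed those of `x`. -/
def orthant {ι : Type*} (S : Finset ι) (x : ι → ℝ) : Set (EuclideanSpace ℝ ι) :=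
  {y | ∀ l ∈ S, y l ≤ x l}

theorem isClosed_orthant {ι : Type*} (S : Finset ι) (x : ι → ℝ) : IsClosed (orthant S x) := by
  have : orthant S x = ⋂ l ∈ S, {y | y l ≤ x l} := by
    ext y; simp [orthant]
  rw [this]
  exact isClosed_biInter fun l _ => isClosed_le (by fun_prop) continuous_const

theorem stdGaussian_orthant {ι : Type*} [Fintype ι] (S : Finset ι) (x : ι → ℝ) :
    (stdGaussian (EuclideanSpace ℝ ι)).real (orthant S x) =
      ∏ l ∈ S, (gaussianReal 0 1).real (Set.Iic (x l)) := by
  classical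
  have hm := (isClosed_orthant S x).measurableSet
  rw [← map_pi_eq_stdGaussian, map_measureReal_apply (by fun_prop) hm]
  have hpre : WithLp.toLp 2 ⁻¹' orthant S x =
      Set.univ.pi fun l => if l ∈ S then Set.Iic (x l) else Set.univ := by
    ext y
    simp only [orthant, Set.mem_preimage, Set.mem_ofPred_eq, Set.mem_pi, Set.mem_univ,
      forall_const]
    refine forall_congr' fun l => ?_
    split_ifs with h <;> simp [h]
  rw [hpre, measureReal_def, Measure.pi_pi, ENNReal.toReal_prod]
  rw [← Finset.prod_subset (Finset.subset_univ S) (fun l _ hl => by simp [hl])]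
  exact Finset.prod_congr rfl fun l hl => by simp [hl, measureReal_def]

/-- A boundary point lies on some hyperplane `y l = x l`, which is null because the one-dimensional
Gaussian has no atoms. -/
theorem stdGaussian_frontier_orthant {ι : Type*} [Fintype ι] (S : Finset ι) (x : ι → ℝ) :
    stdGaussian (EuclideanSpace ℝ ι) (frontier (orthant S x)) = 0 := by
  have hcont : ∀ l, Continuous fun y : EuclideanSpace ℝ ι => y l := fun l => by fun_prop
  have hcl := isClosed_orthant S x
  have hop : IsOpen {y : EuclideanSpace ℝ ι | ∀ l ∈ S, y l < x l} := by
    have : {y : EuclideanSpace ℝ ι | ∀ l ∈ S, y l < x l} = ⋂ l ∈ S, {y | y l < x l} := by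
      ext y; simp
    rw [this]
    exact isOpen_biInter_finset fun l _ => isOpen_lt (hcont l) continuous_const
  have hsub : frontier (orthant S x) ⊆ ⋃ l, {y : EuclideanSpace ℝ ι | y l = x l} := by
    intro y hy
    rw [hcl.frontier_eq] at hy
    by_contra hc
    rw [Set.mem_iUnion] at hc
    push Not at hc
    refine hy.2 (interior_maximal (fun y' hy' l hl => (hy' l hl).le) hop ?_)
    exact fun l hl => lt_of_le_of_ne (hy.1 l hl) (hc l)
  refine measure_mono_null hsub (measure_iUnion_null fun l => ?_)
  rw [← map_pi_eq_stdGaussian, Measure.map_apply (by fun_prop)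
    (measurableSet_eq_fun (hcont l).measurable measurable_const)]
  have : NullSingletonClass (gaussianReal 0 1) := nullSingletonClass_gaussianReal one_ne_zero
  exact Measure.pi_hyperplane (fun _ : ι => gaussianReal 0 1) l (x l)

end Silhouette

/-! ### The limit theorem -/

open Silhouette

theorem theorem1 {Ω : Type*} [MeasurableSpace Ω] (P : Measure Ω) [IsProbabilityMeasure P]
    (ξ : ℕ → Ω → ℝ) (hmeas : ∀ n, Measurable (ξ n)) (hindep : iIndepFun ξ P)
    (hunif : ∀ n, pdf.IsUniform (ξ n) (Set.Icc 0 1) P volume)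
    (d : ℕ) (s : Fin d → ℝ) (hs : StrictMono s) (hs01 : ∀ l, s l ∈ Set.Icc (0 : ℝ) 1) :
    TendstoInDistribution
      (fun (n : ℕ) (ω : Ω) =>
        WithLp.toLp 2 (fun l : Fin d =>
          Silhouette.standardizedSilhouette (fun i => ξ i ω) n (s l)))
      atTop (id : EuclideanSpace ℝ (Fin d) → EuclideanSpace ℝ (Fin d))
      (fun _ => P) (stdGaussian (EuclideanSpace ℝ (Fin d))) ∧
    ∀ x : Fin d → ℝ,
      Tendsto
        (fun n : ℕ =>
          P.real {ω | ∀ l, Silhouette.standardizedSilhouette (fun i => ξ i ω) n (s l) ≤ x l} -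
            ∏ l, P.real
              {ω | Silhouette.standardizedSilhouette (fun i => ξ i ω) n (s l) ≤ x l})
        atTop (𝓝 0) := by
  have h := IsIIDNoAtoms.of_uniform hmeas hindep hunif
  set u : Fin d → ℕ → Bool := fun l => binaryDigit (s l) with hu
  have huinj : Function.Injective u := fun l l' hl =>
    hs.injective (binaryDigit_injOn (hs01 l) (hs01 l') hl)
  set Y : ℕ → Ω → EuclideanSpace ℝ (Fin d) := fun n ω => WithLp.toLp 2 (fun l : Fin d =>
    standardizedSilhouette (fun i => ξ i ω) n (s l)) with hY
  -- The version driven by ranks is measurable and agrees with `Y` off the null event of ties.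
  let Z : ℕ → Ω → EuclideanSpace ℝ (Fin d) := fun n ω => WithLp.toLp 2 (fun l : Fin d =>
    (((pathState (u l) (rank fun i => ξ i ω) n).1 : ℝ) - Real.log n) / √(Real.log n))
  have hZm : ∀ n, Measurable (Z n) := fun n =>
    (WithLp.measurable_toLp 2 (Fin d → ℝ)).comp (measurable_pi_lambda _ fun l =>
      (Measurable.of_discrete (f := fun j : ℕ => ((j : ℝ) - Real.log n) / √(Real.log n))).comp
        (measurable_pathState hmeas (u l) n).fst)
  have hYZ : ∀ n, Y n =ᵐ[P] Z n := by
    intro n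
    filter_upwards [h.ae_injective] with ω hω
    simp only [hY, Z, standardizedSilhouette, silhouette_bst hω, hu]
  have hYm : ∀ n, AEMeasurable (Y n) P := fun n => ⟨Z n, hZm n, hYZ n⟩
  have hchar : ∀ t : EuclideanSpace ℝ (Fin d), Tendsto (fun n => charFun (P.map (Y n)) t) atTop
      (𝓝 (charFun (stdGaussian (EuclideanSpace ℝ (Fin d))) t)) := by
    intro t
    have hlim := h.tendsto_integral_monomial huinj fun l => t l
    have ht : Complex.exp (∑ l, -((t l : ℝ) : ℂ) ^ 2 / 2) =
        charFun (stdGaussian (EuclideanSpace ℝ (Fin d))) t := by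
      rw [charFun_stdGaussian, ← Complex.ofReal_pow, EuclideanSpace.real_norm_sq_eq,
        ← Finset.sum_div, Finset.sum_neg_distrib]
      push_cast
      rfl
    rw [ht] at hlim
    refine hlim.congr fun n => ?_
    rw [Measure.map_congr (hYZ n), charFun_apply,
      integral_map (hZm n).aemeasurable (by fun_prop), ← integral_mul_const]
    refine integral_congr_ae (Eventually.of_forall fun ω => ?_)
    simp only [← Complex.exp_nat_mul, ← Complex.exp_sum, ← Complex.exp_add, Z, PiLp.inner_apply]
    congr 1
    rw [← sub_eq_add_neg, ← Finset.sum_sub_distrib]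
    -- The centering contributes `log n / √(log n) = √(log n)`, valid also when `log n = 0`.
    simp only [RCLike.inner_apply, conj_trivial, sub_div, Real.div_sqrt]
    push_cast
    rw [Finset.sum_mul]
    exact Finset.sum_congr rfl fun l _ => by ring
  have hconv : TendstoInDistribution Y atTop
      (id : EuclideanSpace ℝ (Fin d) → EuclideanSpace ℝ (Fin d)) (fun _ => P)
      (stdGaussian (EuclideanSpace ℝ (Fin d))) := by
    refine ⟨hYm, aemeasurable_id, ProbabilityMeasure.tendsto_iff_tendsto_charFun.2 fun t => ?_⟩
    simpa using hchar t
  refine ⟨hconv, fun x => ?_⟩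
  -- `S = univ` gives the joint distribution function and `S = {l}` the marginal ones; the joint
  -- limit is the product of the marginal limits.
  have horth : ∀ S : Finset (Fin d), Tendsto
      (fun n => P.real {ω | ∀ l ∈ S, standardizedSilhouette (fun i => ξ i ω) n (s l) ≤ x l}) atTop
      (𝓝 (∏ l ∈ S, (gaussianReal 0 1).real (Set.Iic (x l)))) := by
    intro S
    have h1 := ProbabilityMeasure.tendsto_measure_of_null_frontier_of_tendsto' hconv.tendsto
      (E := orthant S x) (by simpa using stdGaussian_frontier_orthant S x)
    simp only [ProbabilityMeasure.coe_mk, Measure.map_id] at h1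
    have h2 := (ENNReal.tendsto_toReal (measure_ne_top _ _)).comp h1
    rw [← stdGaussian_orthant S x]
    refine h2.congr fun n => ?_
    simp only [Function.comp]
    rw [Measure.map_apply_of_aemeasurable (hYm n) (isClosed_orthant S x).measurableSet]
    rfl
  have hj := horth Finset.univ
  have hp := tendsto_finsetProd Finset.univ fun l _ => horth {l}
  simp only [Finset.mem_univ, forall_const, Finset.mem_singleton, forall_eq,
    Finset.prod_singleton] at hj hp
  simpa using hj.sub hp
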